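/- Let $L$ be a finite geometric lattice, that is, a finite lattice (with least element $0$ and greatest element $1$) in which every non-zero element is a join of atoms and which is semimodular: whenever $a$ covers $a\wedge b$, the element $a\vee b$ covers $b$. For $x\in L$ let the rank $r(x)$ be the maximum length of a chain $x_0<x_1<\dots<x_n=x$ in $L$ ending at $x$ (such a chain has length $n$), and call $a\in L$ modular if $$r(a\wedge b)+r(a\vee b)=r(a)+r(b)\quad\text{for all } b\in L.$$ Let $\mu_L$ be the Möbius function of $L$, i.e. $\mu_L(x,x)=1$ and $\mu_L(x,y)=-\sum_{x\le z<y}\mu_L(x,z)$ for $x<y$. Let $a$ be a modular element of $L$ with $a\neq 0$ and $a\neq 1$, and let $a^{\perp}=\{x\in L : a\wedge x=0,\ a\vee x=1\}$ be the set of all complements of $a$ in $L$. Then $$\mu_L(0,1)=\mu_L(0,a)\sum_{x\in a^{\perp}}\mu_L(0,x).$$ -/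

import Mathlib

/-- A geometric lattice: a semimodular lattice (if `a` covers `a ⊓ b` then `a ⊔ b` covers `b`)
in which every element is a join of atoms (the bottom element being the empty join).
Finiteness is a separate hypothesis. -/
class IsGeometricLattice (L : Type*) [Lattice L] [BoundedOrder L] : Prop extends
    IsUpperModularLattice L, IsAtomistic L

/-- `a` is a modular element: `r (a ⊓ b) + r (a ⊔ b) = r a + r b` for all `b`, where the rank
`r x = Order.height x` is the maximal length of a chain ending at `x`. -/
def IsModularElement {L : Type*} [Lattice L] (a : L) : Prop :=
  ∀ b : L, Order.height (a ⊓ b) + Order.height (a ⊔ b) = Order.height a + Order.height b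

/-!
For `x ≤ a` and `y` disjoint from `a`, weight the pair `(x, y)` by `μ ⊥ x * μ ⊥ y`. The pairs with
`x ⊔ y ≤ w` have total weight `∑ x ≤ a ⊓ w, μ ⊥ x` times a sum over `y ≤ w`; the first factor
vanishes unless `a` is disjoint from `w`, and then the second one is `∑ y ≤ w, μ ⊥ y`. So the total
is `1` if `w = ⊥` and `0` otherwise, and Möbius inversion shows that the pairs with `x ⊔ y = z`
have total weight `μ ⊥ z`. This holds in every finite lattice.

In a semimodular lattice the rank is submodular, so the rank identity defining a modular element
`a` yields the modular law `(a ⊓ y) ⊔ x = a ⊓ (y ⊔ x)` for `x ≤ a`. For `z = ⊤` this law leaves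
only the pairs `(a, y)` with `y` a complement of `a`.
-/

section Semimodular

open Order

variable {L : Type*} [Lattice L] [WellFoundedLT L] [WellFoundedGT L]

-- Semimodularity produces covers only upwards, so the Jordan–Dedekind property is proved for
-- `coheight` first and transferred to `height` through the constancy of their sum.
lemma coheight_eq_coheight_add_one_of_covBy [IsWeakUpperModularLattice L] {a b : L}
    (hab : a ⋖ b) : coheight a = coheight b + 1 := by
  induction a using WellFoundedGT.induction generalizing b with
  | ind a ih =>
    refine le_antisymm ?_ (coheight_add_one_le hab.lt)
    rw [coheight_eq_iSup_gt_coheight]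
    refine iSup₂_le fun w haw ↦ add_le_add_left ?_ 1
    obtain ⟨v, hav, hvw⟩ := exists_covBy_le_of_lt haw
    obtain rfl | hvb := eq_or_ne v b
    · exact coheight_anti hvw
    have hinf : v ⊓ b = a := hav.wcovBy.inf_eq hab.wcovBy hvb
    have hv : v ⋖ v ⊔ b := by
      apply covBy_sup_of_inf_covBy_of_inf_covBy_left <;> rwa [hinf]
    have hb : b ⋖ v ⊔ b := by
      apply covBy_sup_of_inf_covBy_of_inf_covBy_right <;> rwa [hinf]
    calc coheight w ≤ coheight v := coheight_anti hvw
      _ = coheight (v ⊔ b) + 1 := ih v hav.lt hv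
      _ = coheight b := (ih b hab.lt hb).symm

lemma coheight_ne_top [IsWeakUpperModularLattice L] [OrderTop L] (x : L) : coheight x ≠ ⊤ := by
  induction x using WellFoundedGT.induction with
  | ind x ih =>
    obtain rfl | hx := eq_or_ne x ⊤
    · simp
    obtain ⟨y, hxy, -⟩ := exists_covBy_le_of_lt hx.lt_top
    rw [coheight_eq_coheight_add_one_of_covBy hxy]
    exact WithTop.add_ne_top.2 ⟨ih y hxy.lt, ENat.one_ne_top⟩

variable [BoundedOrder L]

lemma height_add_coheight_eq_coheight_bot [IsWeakUpperModularLattice L] (x : L) :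
    height x + coheight x = coheight (⊥ : L) := by
  refine le_antisymm ?_ ?_
  · rw [← WithBot.coe_le_coe, coheight_bot_eq_krullDim,
      krullDim_eq_iSup_height_add_coheight_of_nonempty]
    exact WithBot.coe_le_coe.2 (le_iSup (fun y : L ↦ height y + coheight y) x)
  · induction x using WellFoundedLT.induction with
    | ind x ih =>
      obtain rfl | hx := eq_or_ne x ⊥
      · simp
      obtain ⟨y, -, hyx⟩ := exists_le_covBy_of_lt hx.bot_lt
      calc coheight (⊥ : L) ≤ height y + coheight y := ih y hyx.lt
        _ = height y + 1 + coheight x := by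
          rw [coheight_eq_coheight_add_one_of_covBy hyx, add_assoc, add_comm 1]
        _ ≤ height x + coheight x := by gcongr; exact height_add_one_le hyx.lt

lemma height_ne_top [IsWeakUpperModularLattice L] (x : L) : height x ≠ ⊤ :=
  (WithTop.add_ne_top.1 (height_add_coheight_eq_coheight_bot x ▸ coheight_ne_top (⊥ : L))).1

lemma height_eq_height_add_one_of_covBy [IsWeakUpperModularLattice L] {a b : L} (hab : a ⋖ b) :
    height b = height a + 1 := by
  refine ENat.add_left_injective_of_ne_top (coheight_ne_top b) ?_
  calc height b + coheight b = height a + coheight a := by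
        simp only [height_add_coheight_eq_coheight_bot]
    _ = height a + 1 + coheight b := by
        rw [coheight_eq_coheight_add_one_of_covBy hab, add_assoc, add_comm 1]

lemma height_sup_add_height_inf_le [IsUpperModularLattice L] (x y : L) :
    height (x ⊔ y) + height (x ⊓ y) ≤ height x + height y := by
  induction x using WellFoundedLT.induction with
  | ind x ih =>
    obtain hxy | hxy := (inf_le_left : x ⊓ y ≤ x).eq_or_lt
    · rw [hxy, sup_eq_right.2 (inf_eq_left.1 hxy), add_comm]
    obtain ⟨z, hz, hzx⟩ := exists_le_covBy_of_lt hxy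
    have hinf : z ⊓ y = x ⊓ y :=
      le_antisymm (inf_le_inf_right y hzx.le) (le_inf hz inf_le_right)
    have hsup : height (x ⊔ y) ≤ height (z ⊔ y) + 1 := by
      have hxzy : x ⊔ (z ⊔ y) = x ⊔ y := by rw [← sup_assoc, sup_eq_left.2 hzx.le]
      obtain h | h := hzx.eq_or_eq (le_inf hzx.le (le_sup_left (b := y))) inf_le_left
      · have hcov : z ⊔ y ⋖ x ⊔ (z ⊔ y) := covBy_sup_of_inf_covBy_left (by rwa [h])
        rw [← hxzy, height_eq_height_add_one_of_covBy hcov]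
      · rw [← hxzy, sup_eq_right.2 (inf_eq_left.1 h)]
        exact le_self_add
    calc height (x ⊔ y) + height (x ⊓ y)
        ≤ height (z ⊔ y) + 1 + height (z ⊓ y) := by rw [hinf]; gcongr
      _ = height (z ⊔ y) + height (z ⊓ y) + 1 := add_right_comm ..
      _ ≤ height z + height y + 1 := add_le_add_left (ih z hzx.lt) 1
      _ = height x + height y := by
        rw [height_eq_height_add_one_of_covBy hzx, add_right_comm]

namespace IsModularElement

variable [IsUpperModularLattice L] {a x : L}

lemma inf_sup_assoc_of_le (ha : IsModularElement a) (y : L) (hxa : x ≤ a) :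
    a ⊓ y ⊔ x = a ⊓ (y ⊔ x) := by
  set u := a ⊓ y ⊔ x with hu
  have hua : u ≤ a := sup_le inf_le_left hxa
  have hle : u ≤ a ⊓ (y ⊔ x) := le_inf hua (sup_le_sup_right inf_le_right x)
  refine hle.eq_or_lt.resolve_right fun hlt ↦ ?_
  refine (height_strictMono hlt (height_ne_top _).lt_top).not_ge ?_
  have hsup : u ⊔ y = y ⊔ x := by
    rw [hu, sup_right_comm, sup_eq_right.2 (inf_le_right : a ⊓ y ≤ y)]
  have hinf : u ⊓ y = a ⊓ y :=
    le_antisymm (inf_le_inf_right y hua) (le_inf le_sup_left inf_le_right)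
  have hsub : height (y ⊔ x) + height (a ⊓ y) ≤ height u + height y := by
    simpa only [hsup, hinf] using height_sup_add_height_inf_le u y
  have hmod : height (a ⊓ (y ⊔ x)) + height (a ⊔ y) = height a + height (y ⊔ x) := by
    simpa only [sup_left_comm a y x, sup_eq_left.2 hxa, sup_comm y a] using ha (y ⊔ x)
  refine (ENat.add_le_add_iff_right
    (WithTop.add_ne_top.2 ⟨height_ne_top (a ⊔ y), height_ne_top y⟩)).1 ?_
  calc height (a ⊓ (y ⊔ x)) + (height (a ⊔ y) + height y)
      = height (y ⊔ x) + (height a + height y) := by rw [← add_assoc, hmod]; abel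
    _ = height (y ⊔ x) + height (a ⊓ y) + height (a ⊔ y) := by rw [← ha y, add_assoc]
    _ ≤ height u + height y + height (a ⊔ y) := by gcongr
    _ = height u + (height (a ⊔ y) + height y) := by abel

lemma eq_of_le_of_sup_eq_top (ha : IsModularElement a) {y : L} (hxa : x ≤ a) (hay : a ⊓ y = ⊥)
    (hxy : x ⊔ y = ⊤) : x = a :=
  calc x = a ⊓ y ⊔ x := by rw [hay, bot_sup_eq]
    _ = a ⊓ (y ⊔ x) := ha.inf_sup_assoc_of_le y hxa
    _ = a := by rw [sup_comm, hxy, inf_top_eq]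

end IsModularElement

end Semimodular

section Moebius

open Finset IncidenceAlgebra

/-- The join-convolution of `f` restricted to `s` with `g` restricted to `t`: the product of
`∑ x ∈ s, f x • x` and `∑ y ∈ t, g y • y` in the semigroup algebra of `(α, ⊔)`.
Summing over `Iic w` turns it into an ordinary product. -/
def supConv {α R : Type*} [SemilatticeSup α] [DecidableEq α] [NonUnitalNonAssocSemiring R]
    (s t : Finset α) (f g : α → R) (z : α) : R :=
  ∑ p ∈ s ×ˢ t with p.1 ⊔ p.2 = z, f p.1 * g p.2

lemma sum_Iic_supConv {α R : Type*} [SemilatticeSup α] [LocallyFiniteOrderBot α] [DecidableEq α]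
    [NonUnitalNonAssocSemiring R] (s t : Finset α) (f g : α → R) (w : α) :
    ∑ z ∈ Iic w, supConv s t f g z = (∑ x ∈ s ∩ Iic w, f x) * ∑ y ∈ t ∩ Iic w, g y := by
  simp only [supConv]
  rw [sum_fiberwise_eq_sum_filter, sum_mul_sum, ← sum_product' _ _ fun x y ↦ f x * g y]
  congr 1
  ext p
  simp only [mem_filter, mem_product, mem_inter, mem_Iic, sup_le_iff]
  tauto

section OrderBot

variable {α R : Type*} [PartialOrder α] [OrderBot α] [LocallyFiniteOrder α] [DecidableEq α]

lemma sum_Iic_mu_bot [AddCommGroup R] [One R] (w : α) :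
    ∑ z ∈ Iic w, mu R ⊥ z = if w = ⊥ then 1 else 0 := by
  simp only [← Icc_bot, sum_Icc_mu_right, eq_comm]

lemma eq_mu_bot_of_sum_Iic_eq [Ring R] {f : α → R}
    (hf : ∀ w, ∑ z ∈ Iic w, f z = if w = ⊥ then 1 else 0) (z : α) : f z = mu R ⊥ z := by
  rw [moebius_inversion_bot f _ (fun w ↦ (hf w).symm) z]
  simp

end OrderBot

variable {L R : Type*} [Lattice L] [BoundedOrder L] [Fintype L] [DecidableEq L]
  [LocallyFiniteOrder L] [Ring R]

lemma supConv_mu_bot (a z : L) :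
    supConv (Iic a) ({y | a ⊓ y = ⊥} : Finset L) (mu R ⊥) (mu R ⊥) z = mu R ⊥ z := by
  refine eq_mu_bot_of_sum_Iic_eq (fun w ↦ ?_) z
  have hIic : Iic a ∩ Iic w = Iic (a ⊓ w) := by ext; simp
  rw [sum_Iic_supConv, hIic, sum_Iic_mu_bot]
  by_cases haw : a ⊓ w = ⊥
  · have hdisj : ({y | a ⊓ y = ⊥} : Finset L) ∩ Iic w = Iic w := by
      refine inter_eq_right.2 fun y hy ↦ mem_filter.2 ⟨mem_univ y, ?_⟩
      exact le_bot_iff.1 (haw ▸ inf_le_inf_left a (mem_Iic.1 hy))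
    rw [if_pos haw, one_mul, hdisj, sum_Iic_mu_bot]
  · have hw : w ≠ ⊥ := fun h ↦ haw (by rw [h, inf_bot_eq])
    rw [if_neg haw, if_neg hw, zero_mul]

lemma IsModularElement.filter_sup_eq_top [IsUpperModularLattice L] {a : L}
    [DecidablePred (IsCompl a)] (ha : IsModularElement a) :
    {p ∈ Iic a ×ˢ ({y | a ⊓ y = ⊥} : Finset L) | p.1 ⊔ p.2 = ⊤} =
      {a} ×ˢ ({y | IsCompl a y} : Finset L) := by
  ext ⟨x, y⟩
  simp only [mem_filter, mem_product, mem_Iic, mem_univ, true_and, mem_singleton, isCompl_iff,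
    disjoint_iff, codisjoint_iff]
  constructor
  · rintro ⟨⟨hxa, hay⟩, hxy⟩
    obtain rfl := ha.eq_of_le_of_sup_eq_top hxa hay hxy
    exact ⟨rfl, hay, hxy⟩
  · rintro ⟨rfl, hay, hxy⟩
    exact ⟨⟨le_rfl, hay⟩, hxy⟩

theorem theorem14p2_general [IsUpperModularLattice L] (a : L) [DecidablePred (IsCompl a)]
    (ha : IsModularElement a) :
    mu R (⊥ : L) ⊤ = mu R ⊥ a * ∑ x with IsCompl a x, mu R ⊥ x := by
  rw [← supConv_mu_bot a ⊤, supConv, ha.filter_sup_eq_top, sum_product, sum_singleton, mul_sum]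

end Moebius

theorem theorem14p2 {L : Type*} [Lattice L] [BoundedOrder L] [Fintype L] [DecidableEq L]
    [LocallyFiniteOrder L] [IsGeometricLattice L] (a : L) [DecidablePred (IsCompl a)]
    (ha : IsModularElement a) (ha0 : a ≠ ⊥) (ha1 : a ≠ ⊤) :
    IncidenceAlgebra.mu ℤ (⊥ : L) ⊤ =
      IncidenceAlgebra.mu ℤ ⊥ a *
        ∑ x ∈ Finset.univ.filter (fun x : L => IsCompl a x), IncidenceAlgebra.mu ℤ ⊥ x :=
  theorem14p2_general a ha
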